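/- Let $G$ be a locally compact, second countable Hausdorff topological group. Let $\mathcal{R}=(U_{\mathcal R},\mathsf{E}_{\mathcal R},\mathcal{H}_{\mathcal R})$ be a principal quantum reference frame: $\mathcal{H}_{\mathcal R}\neq 0$ is a complex Hilbert space, $U_{\mathcal R}$ is a strongly continuous unitary representation of $G$ on $\mathcal{H}_{\mathcal R}$, and $\mathsf{E}_{\mathcal R}$ is a normalized positive operator-valued measure on the Borel sets of a principal homogeneous $G$-space $\Sigma$ (a topological $G$-space all of whose orbit maps $g\mapsto g.o$ are homeomorphisms $G\to\Sigma$), with values in $B(\mathcal{H}_{\mathcal R})$, which is covariant: $\mathsf{E}_{\mathcal R}(g.X)=U_{\mathcal R}(g)\mathsf{E}_{\mathcal R}(X)U_{\mathcal R}(g)^*$. Fix a base point $o\in\Sigma$ and identify $\Sigma$ with $G$ through $g\mapsto g.o$. Let $U_{\mathcal S}$ be a strongly continuous unitary representation of $G$ on a complex Hilbert space $\mathcal{H}_{\mathcal S}$, and let $B(\mathcal{H}_{\mathcal R}\otimes\mathcal{H}_{\mathcal S})^G$ be the space of bounded operators invariant under conjugation by all $U_{\mathcal R}(g)\otimes U_{\mathcal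 S}(g)$. The relativization map $$\yen^{\mathcal R}: B(\mathcal{H}_{\mathcal S})\to B(\mathcal{H}_{\mathcal R}\otimes\mathcal{H}_{\mathcal S})^G,\qquad \yen^{\mathcal R}(A)=\int_G d\mathsf{E}_{\mathcal R}(g)\otimes U_{\mathcal S}(g)AU_{\mathcal S}(g)^*,$$ is the linear map determined by $$\langle\varphi\otimes\psi,\ \yen^{\mathcal R}(A)\,(\varphi\otimes\psi)\rangle=\int_G\langle\psi,\,U_{\mathcal S}(g)AU_{\mathcal S}(g)^*\psi\rangle\, d\langle\varphi,\mathsf{E}_{\mathcal R}(g)\varphi\rangle\qquad(\varphi\in\mathcal{H}_{\mathcal R},\ \psi\in\mathcal{H}_{\mathcal S}).$$ Suppose that $\mathcal{R}$ is localizable, that is, $\|\mathsf{E}_{\mathcal R}(X)\|=1$ for every Borel set $X$ with $\mathsf{E}_{\mathcal R}(X)\neq 0$. Then $\yen^{\mathcal R}$ is isometric, $\|\yen^{\mathcal R}(A)\|=\|A\|$ for all $A\in B(\mathcal{H}_{\mathcal S})$; in particular it is injective. -/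

import Mathlib

open scoped TensorProduct InnerProductSpace
open MeasureTheory Filter Topology

noncomputable section

set_option linter.unusedSectionVars false

/-- A (normalized) positive operator-valued measure on the measurable space `Ω` with values in the
bounded operators of the Hilbert space `H`, countably additive in the weak operator topology.
Only the values on measurable sets matter. -/
structure POVM (Ω : Type*) [MeasurableSpace Ω] (H : Type*) [NormedAddCommGroup H]
    [InnerProductSpace ℂ H] where
  /-- The effect attached to a measurable set. -/
  effect : Set Ω → (H →L[ℂ] H)
  effect_isPositive : ∀ X, MeasurableSet X → (effect X).IsPositive
  effect_univ : effect Set.univ = 1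
  effect_hasSum : ∀ X : ℕ → Set Ω, (∀ n, MeasurableSet (X n)) →
    Pairwise (fun m n => Disjoint (X m) (X n)) →
    ∀ φ ψ : H, HasSum (fun n => ⟪φ, effect (X n) ψ⟫_ℂ) ⟪φ, effect (⋃ n, X n) ψ⟫_ℂ

namespace POVM

variable {Ω : Type*} [MeasurableSpace Ω] {H : Type*} [NormedAddCommGroup H]
  [InnerProductSpace ℂ H] (E : POVM Ω H)

/-- The norm-1 property: every non-zero effect has norm one. -/
def IsLocalizable : Prop :=
  ∀ X, MeasurableSet X → E.effect X ≠ 0 → ‖E.effect X‖ = 1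

theorem effect_empty_inner (φ ψ : H) : ⟪φ, E.effect ∅ ψ⟫_ℂ = 0 := by
  have h := E.effect_hasSum (fun _ => ∅) (fun _ => MeasurableSet.empty)
    (fun _ _ _ => disjoint_bot_left) φ ψ
  exact tendsto_nhds_unique tendsto_const_nhds h.summable.tendsto_atTop_zero

theorem re_inner_effect_nonneg {X : Set Ω} (hX : MeasurableSet X) (φ : H) :
    0 ≤ (⟪φ, E.effect X φ⟫_ℂ).re :=
  (E.effect_isPositive X hX).re_inner_nonneg_right φ

theorem inner_effect_eq_re {X : Set Ω} (hX : MeasurableSet X) (φ : H) :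
    ⟪φ, E.effect X φ⟫_ℂ = ((⟪φ, E.effect X φ⟫_ℂ).re : ℂ) := by
  have h := (E.effect_isPositive X hX).inner_nonneg_right φ
  exact Complex.ext rfl (by simpa using (Complex.le_def.1 h).2.symm)

/-- The outcome measure `X ↦ ⟨φ, E(X) φ⟩` of the vector `φ`
(the Born distribution if `φ` is a unit vector). -/
def outcomeMeasure (φ : H) : Measure Ω :=
  Measure.ofMeasurable (fun X _ => ENNReal.ofReal (⟪φ, E.effect X φ⟫_ℂ).re)
    (by simp [E.effect_empty_inner]) (by
      intro X hX hd
      have h := E.effect_hasSum X hX hd φ φ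
      have h' : HasSum (fun n => (⟪φ, E.effect (X n) φ⟫_ℂ).re)
          (⟪φ, E.effect (⋃ n, X n) φ⟫_ℂ).re := Complex.hasSum_re h
      rw [← h'.tsum_eq]
      exact ENNReal.ofReal_tsum_of_nonneg (fun n => E.re_inner_effect_nonneg (hX n) φ) h'.summable)

theorem outcomeMeasure_apply {X : Set Ω} (hX : MeasurableSet X) (φ : H) :
    E.outcomeMeasure φ X = ENNReal.ofReal (⟪φ, E.effect X φ⟫_ℂ).re :=
  Measure.ofMeasurable_apply X hX

theorem outcomeMeasure_real {X : Set Ω} (hX : MeasurableSet X) (φ : H) :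
    ((E.outcomeMeasure φ).real X : ℂ) = ⟪φ, E.effect X φ⟫_ℂ := by
  rw [Measure.real, E.outcomeMeasure_apply hX, ENNReal.toReal_ofReal
    (E.re_inner_effect_nonneg hX φ), ← E.inner_effect_eq_re hX]

theorem outcomeMeasure_univ (φ : H) :
    (E.outcomeMeasure φ) Set.univ = ENNReal.ofReal (‖φ‖ ^ 2) := by
  rw [E.outcomeMeasure_apply MeasurableSet.univ, E.effect_univ]
  simp [inner_self_eq_norm_sq_to_K, ← Complex.ofReal_pow]

instance (φ : H) : IsFiniteMeasure (E.outcomeMeasure φ) :=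
  ⟨by rw [E.outcomeMeasure_univ]; exact ENNReal.ofReal_lt_top⟩

end POVM

section HilbertTensor

variable {H K : Type*} [NormedAddCommGroup H] [InnerProductSpace ℂ H]
  [NormedAddCommGroup K] [InnerProductSpace ℂ K]

/-- The Hilbert space tensor product: the completion of the algebraic tensor product. -/
abbrev HilbertTensor (H K : Type*) [NormedAddCommGroup H] [InnerProductSpace ℂ H]
    [NormedAddCommGroup K] [InnerProductSpace ℂ K] : Type _ :=
  UniformSpace.Completion (H ⊗[ℂ] K)

/-- The product vector `φ ⊗ ψ` in the Hilbert space tensor product. -/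
def prodVec (φ : H) (ψ : K) : HilbertTensor H K := ((φ ⊗ₜ[ℂ] ψ : H ⊗[ℂ] K) : HilbertTensor H K)

/-- The tensor product `A ⊗ B` of bounded operators on the Hilbert space tensor product. -/
def prodOp (A : H →L[ℂ] H) (B : K →L[ℂ] K) : HilbertTensor H K →L[ℂ] HilbertTensor H K :=
  (TensorProduct.mapL A B).completion

@[simp] theorem prodOp_prodVec (A : H →L[ℂ] H) (B : K →L[ℂ] K) (φ : H) (ψ : K) :
    prodOp A B (prodVec φ ψ) = prodVec (A φ) (B ψ) := by
  simp [prodOp, prodVec]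

theorem inner_prodVec (φ φ' : H) (ψ ψ' : K) :
    ⟪prodVec φ ψ, prodVec φ' ψ'⟫_ℂ = ⟪φ, φ'⟫_ℂ * ⟪ψ, ψ'⟫_ℂ := by
  simp [prodVec]

theorem prodVec_add_left (φ φ' : H) (ψ : K) :
    prodVec (φ + φ') ψ = prodVec φ ψ + prodVec φ' ψ := by
  simp [prodVec, TensorProduct.add_tmul, UniformSpace.Completion.coe_add]

theorem prodVec_add_right (φ : H) (ψ ψ' : K) :
    prodVec φ (ψ + ψ') = prodVec φ ψ + prodVec φ ψ' := by
  simp [prodVec, TensorProduct.tmul_add, UniformSpace.Completion.coe_add]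

theorem prodVec_smul_left (c : ℂ) (φ : H) (ψ : K) :
    prodVec (c • φ) ψ = c • prodVec φ ψ := by
  simp [prodVec, ← TensorProduct.smul_tmul', UniformSpace.Completion.coe_smul]

theorem prodVec_smul_right (c : ℂ) (φ : H) (ψ : K) :
    prodVec φ (c • ψ) = c • prodVec φ ψ := by
  simp [prodVec, UniformSpace.Completion.coe_smul]

/-- Operators on the tensor product are determined by their matrix elements between
product vectors. -/
theorem prodOp_ext {S T : HilbertTensor H K →L[ℂ] HilbertTensor H K}
    (h : ∀ φ φ' ψ ψ', ⟪prodVec φ ψ, S (prodVec φ' ψ')⟫_ℂ = ⟪prodVec φ ψ, T (prodVec φ' ψ')⟫_ℂ) :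
    S = T := by
  have key : ∀ x y : HilbertTensor H K, ⟪x, S y⟫_ℂ = ⟪x, T y⟫_ℂ := by
    intro x y
    induction x, y using UniformSpace.Completion.induction_on₂ with
    | hp => exact isClosed_eq (by fun_prop) (by fun_prop)
    | ih a b =>
      induction a using TensorProduct.induction_on with
      | zero => simp [UniformSpace.Completion.coe_zero]
      | add a a' ha ha' =>
        simp only [UniformSpace.Completion.coe_add, inner_add_left, ha, ha']
      | tmul φ ψ =>
        induction b using TensorProduct.induction_on with
        | zero => simp [UniformSpace.Completion.coe_zero]
        | add a a' ha ha' =>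
          simp only [UniformSpace.Completion.coe_add, map_add, inner_add_right, ha, ha']
        | tmul φ' ψ' => exact h φ φ' ψ ψ'
  ext y
  exact ext_inner_left ℂ fun x => key x y

theorem sesq_eq_zero {V : Type*} [AddCommGroup V] [Module ℂ V] (b : V → V → ℂ)
    (hl : ∀ x y z, b (x + y) z = b x z + b y z) (hr : ∀ x y z, b x (y + z) = b x y + b x z)
    (hls : ∀ (c : ℂ) x y, b (c • x) y = (starRingEnd ℂ) c * b x y)
    (hrs : ∀ (c : ℂ) x y, b x (c • y) = c * b x y) (h : ∀ x, b x x = 0) (x y : V) :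
    b x y = 0 := by
  have h1 := h (x + y)
  have h2 := h (x + Complex.I • y)
  simp only [hl, hr, hls, hrs, h, Complex.conj_I] at h1 h2
  have h3 : Complex.I * (b x y - b y x) = 0 := by linear_combination h2
  have h4 : b x y - b y x = 0 := by simpa using h3
  linear_combination (h1 + h4) / 2

/-- Operators on the tensor product are determined by their expectation values in
product vectors. -/
theorem prodOp_ext_diag {S T : HilbertTensor H K →L[ℂ] HilbertTensor H K}
    (h : ∀ φ ψ, ⟪prodVec φ ψ, S (prodVec φ ψ)⟫_ℂ = ⟪prodVec φ ψ, T (prodVec φ ψ)⟫_ℂ) :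
    S = T := by
  refine prodOp_ext fun φ φ' ψ ψ' => ?_
  have h1 : ∀ φ ψ ψ', ⟪prodVec φ ψ, (S - T) (prodVec φ ψ')⟫_ℂ = 0 := fun φ ψ ψ' =>
    sesq_eq_zero (fun ψ ψ' => ⟪prodVec φ ψ, (S - T) (prodVec φ ψ')⟫_ℂ)
      (by intros; simp only [prodVec_add_right, inner_add_left])
      (by intros; simp only [prodVec_add_right, map_add, inner_add_right])
      (by intros; simp only [prodVec_smul_right, inner_smul_left])
      (by intros; simp only [prodVec_smul_right, map_smul, inner_smul_right])
      (by intro ψ; simp [inner_sub_right, h]) ψ ψ'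
  have h2 := sesq_eq_zero (fun φ φ' => ⟪prodVec φ ψ, (S - T) (prodVec φ' ψ')⟫_ℂ)
      (by intros; simp only [prodVec_add_left, inner_add_left])
      (by intros; simp only [prodVec_add_left, map_add, inner_add_right])
      (by intros; simp only [prodVec_smul_left, inner_smul_left])
      (by intros; simp only [prodVec_smul_left, map_smul, inner_smul_right])
      (fun φ => h1 φ ψ ψ') φ φ'
  simpa [inner_sub_right, sub_eq_zero] using h2

theorem prodOp_mul (A A' : H →L[ℂ] H) (B B' : K →L[ℂ] K) :
    prodOp A B * prodOp A' B' = prodOp (A * A') (B * B') :=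
  prodOp_ext fun φ φ' ψ ψ' => by simp

theorem prodOp_one : prodOp (1 : H →L[ℂ] H) (1 : K →L[ℂ] K) = 1 :=
  prodOp_ext fun φ φ' ψ ψ' => by simp

theorem prodOp_adjoint [CompleteSpace H] [CompleteSpace K] (A : H →L[ℂ] H) (B : K →L[ℂ] K) :
    ContinuousLinearMap.adjoint (prodOp A B) =
      prodOp (ContinuousLinearMap.adjoint A) (ContinuousLinearMap.adjoint B) :=
  prodOp_ext fun φ φ' ψ ψ' => by
    simp [ContinuousLinearMap.adjoint_inner_right, inner_prodVec]

theorem norm_prodOp_le (A : H →L[ℂ] H) (B : K →L[ℂ] K) : ‖prodOp A B‖ ≤ ‖A‖ * ‖B‖ := by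
  refine ContinuousLinearMap.opNorm_le_bound _ (by positivity) fun x => ?_
  induction x using UniformSpace.Completion.induction_on with
  | hp => exact isClosed_le (by fun_prop) (by fun_prop)
  | ih a =>
    simp only [prodOp, ContinuousLinearMap.completion_apply_coe, UniformSpace.Completion.norm_coe]
    exact (ContinuousLinearMap.le_opNorm _ _).trans
      (mul_le_mul_of_nonneg_right (TensorProduct.norm_mapL_le A B) (norm_nonneg _))

end HilbertTensor

section OperatorIntegral

variable {Ω : Type*} [MeasurableSpace Ω] {H K : Type*} [NormedAddCommGroup H]
  [InnerProductSpace ℂ H] [NormedAddCommGroup K] [InnerProductSpace ℂ K]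

/-- `T = ∫ dE(x) ⊗ f(x)`: the bounded operator `T` on `H ⊗ K` satisfies
`⟨φ ⊗ ψ, T (φ ⊗ ψ)⟩ = ∫ ⟨ψ, f(x) ψ⟩ d⟨φ, E(x) φ⟩` for all vectors `φ`, `ψ`. -/
def IsOperatorIntegral (E : POVM Ω H) (f : Ω → (K →L[ℂ] K))
    (T : HilbertTensor H K →L[ℂ] HilbertTensor H K) : Prop :=
  ∀ (φ : H) (ψ : K),
    ⟪prodVec φ ψ, T (prodVec φ ψ)⟫_ℂ = ∫ x, ⟪ψ, f x ψ⟫_ℂ ∂(E.outcomeMeasure φ)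

theorem IsOperatorIntegral.unique {E : POVM Ω H} {f : Ω → (K →L[ℂ] K)}
    {S T : HilbertTensor H K →L[ℂ] HilbertTensor H K}
    (hS : IsOperatorIntegral E f S) (hT : IsOperatorIntegral E f T) : S = T :=
  prodOp_ext_diag fun φ ψ => (hS φ ψ).trans (hT φ ψ).symm

theorem norm_inner_apply_le {f : Ω → (K →L[ℂ] K)} {M : ℝ} (hM : ∀ x, ‖f x‖ ≤ M) (ψ : K) (x : Ω) :
    ‖⟪ψ, f x ψ⟫_ℂ‖ ≤ M * ‖ψ‖ ^ 2 :=
  calc ‖⟪ψ, f x ψ⟫_ℂ‖ ≤ ‖ψ‖ * ‖f x ψ‖ := norm_inner_le_norm _ _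
    _ ≤ ‖ψ‖ * (M * ‖ψ‖) := by
      gcongr
      exact (f x).le_of_opNorm_le (hM x) ψ
    _ = M * ‖ψ‖ ^ 2 := by ring

theorem integrable_inner_apply (E : POVM Ω H) {f : Ω → (K →L[ℂ] K)} {M : ℝ}
    (hM : ∀ x, ‖f x‖ ≤ M) (hf : ∀ ψ, Measurable fun x => ⟪ψ, f x ψ⟫_ℂ) (φ : H) (ψ : K) :
    Integrable (fun x => ⟪ψ, f x ψ⟫_ℂ) (E.outcomeMeasure φ) :=
  Integrable.of_bound (hf ψ).aestronglyMeasurable (M * ‖ψ‖ ^ 2)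
    (Eventually.of_forall fun x => norm_inner_apply_le hM ψ x)

theorem sum_effect_fiber (E : POVM Ω H) (κ : SimpleFunc Ω ℕ) (N : ℕ) (hκ : ∀ x, κ x ≤ N) :
    ∑ k ∈ Finset.range (N + 1), E.effect (κ ⁻¹' {k}) = 1 := by
  ext ψ
  refine ext_inner_left ℂ fun φ => ?_
  have h := E.effect_hasSum (fun k => κ ⁻¹' {k}) (fun k => κ.measurableSet_fiber k)
    (fun m n hmn => Disjoint.preimage _ (by simpa using hmn)) φ ψ
  have hU : (⋃ k, κ ⁻¹' {k}) = Set.univ := by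
    ext x; simp
  rw [hU, E.effect_univ] at h
  rw [← h.tsum_eq, tsum_eq_sum (s := Finset.range (N + 1))]
  · simp [inner_sum]
  · intro k hk
    have : κ ⁻¹' {k} = ∅ := by
      ext x
      simp only [Set.mem_preimage, Set.mem_singleton_iff, Set.mem_empty_iff_false, iff_false]
      rintro rfl
      exact hk (Finset.mem_range.2 (Nat.lt_succ_of_le (hκ x)))
    rw [this, E.effect_empty_inner]

/-- Riemann sums `∑ E(X_k) ⊗ F_k` over a partition are bounded by `sup ‖F_k‖`. -/
theorem norm_riemannSum_le [CompleteSpace H] [CompleteSpace K] (s : Finset ℕ)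
    (A : ℕ → (H →L[ℂ] H)) (hA : ∀ k ∈ s, (A k).IsPositive) (hsum : ∑ k ∈ s, A k = 1)
    (F : ℕ → (K →L[ℂ] K)) {M : ℝ} (hM0 : 0 ≤ M) (hM : ∀ k, ‖F k‖ ≤ M) :
    ‖∑ k ∈ s, prodOp (A k) (F k)‖ ≤ M := by
  set S : ℕ → (H →L[ℂ] H) := fun k => CFC.sqrt (A k) with hS
  have hSA : ∀ k ∈ s, S k * S k = A k := fun k hk =>
    CFC.sqrt_mul_sqrt_self _ ((ContinuousLinearMap.nonneg_iff_isPositive _).2 (hA k hk))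
  have hSadj : ∀ k, ContinuousLinearMap.adjoint (S k) = S k := fun k =>
    (IsSelfAdjoint.of_nonneg (CFC.sqrt_nonneg (A k))).star_eq
  set R : ℕ → (HilbertTensor H K →L[ℂ] HilbertTensor H K) := fun k => prodOp (S k) 1 with hR
  have hRadj : ∀ k, ContinuousLinearMap.adjoint (R k) = R k := fun k => by
    have h1 : ContinuousLinearMap.adjoint (1 : K →L[ℂ] K) = 1 := star_one _
    simp only [hR, prodOp_adjoint, hSadj, h1]
  have hone : ∑ k ∈ s, prodOp (A k) (1 : K →L[ℂ] K) = 1 := by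
    refine prodOp_ext fun φ φ' ψ ψ' => ?_
    simp only [sum_apply, inner_sum, prodOp_prodVec, inner_prodVec,
      one_apply_eq_self, ← Finset.sum_mul]
    rw [← inner_sum, ← sum_apply, hsum, one_apply_eq_self]
  have hsq : ∀ x : HilbertTensor H K, ∑ k ∈ s, ‖R k x‖ ^ 2 = ‖x‖ ^ 2 := by
    intro x
    have h1 : ∀ k ∈ s, ((‖R k x‖ ^ 2 : ℝ) : ℂ) = ⟪x, prodOp (A k) (1 : K →L[ℂ] K) x⟫_ℂ := by
      intro k hk
      have h2 : prodOp (A k) (1 : K →L[ℂ] K) = R k * R k := by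
        simp [hR, prodOp_mul, hSA k hk]
      rw [h2, mul_apply_eq_comp, ← ContinuousLinearMap.adjoint_inner_left, hRadj,
        inner_self_eq_norm_sq_to_K]
      simp
    have h3 : ((∑ k ∈ s, ‖R k x‖ ^ 2 : ℝ) : ℂ) = ((‖x‖ ^ 2 : ℝ) : ℂ) := by
      rw [Complex.ofReal_sum, Finset.sum_congr rfl h1, ← inner_sum,
        ← sum_apply, hone, one_apply_eq_self,
        inner_self_eq_norm_sq_to_K]
      simp
    exact_mod_cast h3
  have hterm : ∀ x y : HilbertTensor H K, ∀ k ∈ s,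
      ‖⟪x, prodOp (A k) (F k) y⟫_ℂ‖ ≤ M * (‖R k x‖ * ‖R k y‖) := by
    intro x y k hk
    have h2 : prodOp (A k) (F k) = R k * (prodOp 1 (F k) * R k) := by
      simp [hR, prodOp_mul, hSA k hk]
    rw [h2, mul_apply_eq_comp, ← ContinuousLinearMap.adjoint_inner_left, hRadj,
      mul_apply_eq_comp]
    have h4 : ‖prodOp (1 : H →L[ℂ] H) (F k)‖ ≤ M :=
      (norm_prodOp_le _ _).trans <| by
        calc ‖(1 : H →L[ℂ] H)‖ * ‖F k‖ ≤ 1 * M := by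
              gcongr
              · exact ContinuousLinearMap.norm_id_le
              · exact hM k
          _ = M := one_mul M
    calc _ ≤ ‖R k x‖ * ‖prodOp (1 : H →L[ℂ] H) (F k) (R k y)‖ := norm_inner_le_norm _ _
      _ ≤ ‖R k x‖ * (M * ‖R k y‖) := by
        gcongr
        exact ContinuousLinearMap.le_of_opNorm_le _ h4 _
      _ = _ := by ring
  have hbound : ∀ x y : HilbertTensor H K,
      ‖⟪x, (∑ k ∈ s, prodOp (A k) (F k)) y⟫_ℂ‖ ≤ M * (‖x‖ * ‖y‖) := by
    intro x y
    rw [sum_apply, inner_sum]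
    calc _ ≤ ∑ k ∈ s, ‖⟪x, prodOp (A k) (F k) y⟫_ℂ‖ := norm_sum_le _ _
      _ ≤ ∑ k ∈ s, M * (‖R k x‖ * ‖R k y‖) := Finset.sum_le_sum (hterm x y)
      _ = M * ∑ k ∈ s, ‖R k x‖ * ‖R k y‖ := (Finset.mul_sum _ _ _).symm
      _ ≤ M * (√(∑ k ∈ s, ‖R k x‖ ^ 2) * √(∑ k ∈ s, ‖R k y‖ ^ 2)) := by
        gcongr
        exact Real.sum_mul_le_sqrt_mul_sqrt _ _ _
      _ = M * (‖x‖ * ‖y‖) := by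
        rw [hsq, hsq, Real.sqrt_sq (norm_nonneg _), Real.sqrt_sq (norm_nonneg _)]
  refine ContinuousLinearMap.opNorm_le_bound _ hM0 fun y => ?_
  set z := (∑ k ∈ s, prodOp (A k) (F k)) y with hz
  have h5 := hbound z y
  rw [← hz, inner_self_eq_norm_sq_to_K] at h5
  have h6 : ‖z‖ ^ 2 ≤ M * (‖z‖ * ‖y‖) := by simpa using h5
  rcases (norm_nonneg z).eq_or_lt with h0 | h0
  · rw [← h0]; positivity
  · nlinarith

/-- One Riemann sum approximating the expectation values in finitely many vectors `ψ`. -/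
theorem exists_approx_operatorIntegral [CompleteSpace H] [CompleteSpace K] [Nonempty Ω]
    (E : POVM Ω H) {f : Ω → (K →L[ℂ] K)} {M : ℝ} (hM : ∀ x, ‖f x‖ ≤ M)
    (hf : ∀ ψ, Measurable fun x => ⟪ψ, f x ψ⟫_ℂ) (s : Finset K) {ε : ℝ} (hε : 0 < ε) :
    ∃ T : HilbertTensor H K →L[ℂ] HilbertTensor H K, ‖T‖ ≤ M ∧ ∀ φ, ∀ ψ ∈ s,
      ‖⟪prodVec φ ψ, T (prodVec φ ψ)⟫_ℂ - ∫ x, ⟪ψ, f x ψ⟫_ℂ ∂(E.outcomeMeasure φ)‖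
        ≤ ε * ‖φ‖ ^ 2 := by
  classical
  have hM0 : 0 ≤ M := (norm_nonneg _).trans (hM (Classical.arbitrary Ω))
  set h : Ω → (s → ℂ) := fun x ψ => ⟪(ψ : K), f x ψ⟫_ℂ with hh
  have hmeas : Measurable h := measurable_pi_iff.2 fun ψ => hf ψ
  have hbdd : Bornology.IsBounded (Set.range h) := by
    refine isBounded_iff_forall_norm_le.2 ⟨∑ ψ ∈ s, M * ‖ψ‖ ^ 2, ?_⟩
    rintro _ ⟨x, rfl⟩
    refine (pi_norm_le_iff_of_nonneg (Finset.sum_nonneg fun _ _ => by positivity)).2 fun ψ => ?_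
    exact (norm_inner_apply_le hM (ψ : K) x).trans
      (Finset.single_le_sum (f := fun ψ : K => M * ‖ψ‖ ^ 2) (fun _ _ => by positivity) ψ.2)
  obtain ⟨t, hts, htf, ht⟩ :=
    (totallyBounded_iff_subset.1 (hbdd.isCompact_closure.totallyBounded.subset subset_closure)) _ (Metric.dist_mem_uniformity hε)
  have hchoice : ∀ z ∈ t, ∃ x, h x = z := fun z hz => hts hz
  -- enumerate tags
  have htne : t.Nonempty := by
    obtain ⟨x⟩ := ‹Nonempty Ω›
    have := ht ⟨x, rfl⟩
    simp only [Set.mem_iUnion] at this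
    obtain ⟨z, hz, -⟩ := this
    exact ⟨z, hz⟩
  obtain ⟨e, he⟩ := htf.countable.exists_eq_range htne
  have htag : ∀ k, ∃ x, h x = e k := fun k => hchoice _ (he ▸ ⟨k, rfl⟩)
  choose y hy using htag
  obtain ⟨N, hN⟩ : ∃ N, ∀ z ∈ t, ∃ k ≤ N, e k = z := by
    have : ∀ z ∈ t, ∃ k, e k = z := fun z hz => by rw [he] at hz; exact hz
    choose! j hj using this
    refine ⟨htf.toFinset.sup j, fun z hz => ⟨j z, ?_, hj z hz⟩⟩
    exact Finset.le_sup (f := j) (htf.mem_toFinset.2 hz)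
  set κ : SimpleFunc Ω ℕ := (SimpleFunc.nearestPtInd e N).comp h hmeas with hκ
  have hκN : ∀ x, κ x ≤ N := fun x => SimpleFunc.nearestPtInd_le _ _ _
  have hclose : ∀ x, dist (h (y (κ x))) (h x) ≤ ε := by
    intro x
    have := ht ⟨x, rfl⟩
    simp only [Set.mem_iUnion] at this
    obtain ⟨z, hz, hxz⟩ := this
    obtain ⟨k, hk, rfl⟩ := hN z hz
    have h1 := SimpleFunc.edist_nearestPt_le e (h x) hk
    rw [edist_dist, edist_dist, ENNReal.ofReal_le_ofReal_iff dist_nonneg] at h1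
    rw [hy]
    refine h1.trans ?_
    rw [dist_comm]
    exact le_of_lt hxz
  refine ⟨∑ k ∈ Finset.range (N + 1), prodOp (E.effect (κ ⁻¹' {k})) (f (y k)),
    norm_riemannSum_le _ _ (fun k _ => E.effect_isPositive _ (κ.measurableSet_fiber k))
      (sum_effect_fiber E κ N hκN) _ hM0 (fun k => hM _), fun φ ψ hψ => ?_⟩
  set μ := E.outcomeMeasure φ with hμ
  have hsum : ⟪prodVec φ ψ, (∑ k ∈ Finset.range (N + 1),
      prodOp (E.effect (κ ⁻¹' {k})) (f (y k))) (prodVec φ ψ)⟫_ℂ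
      = ∫ x, ⟪ψ, f (y (κ x)) ψ⟫_ℂ ∂μ := by
    have h1 : (fun x => ⟪ψ, f (y (κ x)) ψ⟫_ℂ) = fun x => ∑ k ∈ Finset.range (N + 1),
        (κ ⁻¹' {k}).indicator (fun _ => ⟪ψ, f (y k) ψ⟫_ℂ) x := by
      funext x
      rw [Finset.sum_eq_single (κ x)]
      · simp
      · intro k _ hk
        simp [Set.indicator, hk.symm]
      · intro hk
        exact absurd (Finset.mem_range.2 (Nat.lt_succ_of_le (hκN x))) hk
    rw [h1, integral_finsetSum _ fun k _ =>
      (integrable_const _).indicator (κ.measurableSet_fiber k)]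
    simp only [sum_apply, inner_sum, prodOp_prodVec, inner_prodVec]
    refine Finset.sum_congr rfl fun k _ => ?_
    rw [integral_indicator_const _ (κ.measurableSet_fiber k),
      ← E.outcomeMeasure_real (κ.measurableSet_fiber k), Complex.real_smul]
  have hint : Integrable (fun x => ⟪ψ, f (y (κ x)) ψ⟫_ℂ) μ := by
    refine Integrable.of_bound (C := M * ‖ψ‖ ^ 2) ?_
      (Eventually.of_forall fun x => norm_inner_apply_le hM ψ _)
    exact (κ.map fun k => ⟪ψ, f (y k) ψ⟫_ℂ).measurable.aestronglyMeasurable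
  rw [hsum, ← integral_sub hint (integrable_inner_apply E hM hf φ ψ)]
  have hb := norm_integral_le_of_norm_le_const (μ := μ) (C := ε)
    (f := fun x => ⟪ψ, f (y (κ x)) ψ⟫_ℂ - ⟪ψ, f x ψ⟫_ℂ)
    (Eventually.of_forall fun x => by
      have h2 := (dist_le_pi_dist (h (y (κ x))) (h x) ⟨ψ, hψ⟩).trans (hclose x)
      rwa [dist_eq_norm] at h2)
  rwa [Measure.real, E.outcomeMeasure_univ, ENNReal.toReal_ofReal (by positivity)] at hb

/-- Bounded, weakly measurable operator-valued functions have an operator integral, which is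
bounded by their supremum norm. -/
theorem exists_isOperatorIntegral [CompleteSpace H] [CompleteSpace K]
    (E : POVM Ω H) {f : Ω → (K →L[ℂ] K)} {M : ℝ} (hM0 : 0 ≤ M) (hM : ∀ x, ‖f x‖ ≤ M)
    (hf : ∀ ψ, Measurable fun x => ⟪ψ, f x ψ⟫_ℂ) :
    ∃ T : HilbertTensor H K →L[ℂ] HilbertTensor H K, ‖T‖ ≤ M ∧ IsOperatorIntegral E f T := by
  classical
  rcases isEmpty_or_nonempty Ω with hΩ | hΩ
  · refine ⟨0, (norm_zero (E := HilbertTensor H K →L[ℂ] HilbertTensor H K)).trans_le hM0, fun φ ψ => ?_⟩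
    have : E.outcomeMeasure φ = 0 := Measure.eq_zero_of_isEmpty _
    simp [this]
  choose T hTM hT using fun i : Finset K × ℕ =>
    exists_approx_operatorIntegral E hM hf i.1 (ε := 1 / ((i.2 : ℝ) + 1)) (by positivity)
  set 𝒰 : Ultrafilter (Finset K × ℕ) := Ultrafilter.of atTop with h𝒰
  have h𝒰le : (𝒰 : Filter (Finset K × ℕ)) ≤ atTop := Ultrafilter.of_le _
  have hbd : ∀ x y i, ‖⟪x, T i y⟫_ℂ‖ ≤ M * ‖x‖ * ‖y‖ := fun x y i =>
    calc _ ≤ ‖x‖ * ‖T i y‖ := norm_inner_le_norm _ _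
      _ ≤ ‖x‖ * (M * ‖y‖) := by
        gcongr
        exact ContinuousLinearMap.le_of_opNorm_le _ (hTM i) _
      _ = _ := by ring
  have hlim : ∀ x y, ∃ b : ℂ, Tendsto (fun i => ⟪x, T i y⟫_ℂ) 𝒰 (𝓝 b) := by
    intro x y
    obtain ⟨b, -, hb⟩ := (isCompact_closedBall (0 : ℂ) (M * ‖x‖ * ‖y‖)).ultrafilter_le_nhds
      (𝒰.map fun i => ⟪x, T i y⟫_ℂ) (by
        rw [le_principal_iff]
        refine Ultrafilter.mem_map.2 (Filter.univ_mem' fun i => ?_)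
        simpa using hbd x y i)
    exact ⟨b, hb⟩
  choose b hb using hlim
  have hbb : ∀ x y, ‖b x y‖ ≤ M * ‖x‖ * ‖y‖ := fun x y =>
    le_of_tendsto (f := fun i => ‖⟪x, T i y⟫_ℂ‖) (hb x y).norm
      (Eventually.of_forall fun i => hbd x y i)
  let B : HilbertTensor H K →L⋆[ℂ] HilbertTensor H K →L[ℂ] ℂ :=
    (LinearMap.mk₂'ₛₗ (starRingEnd ℂ) (RingHom.id ℂ) b
      (fun x x' y => tendsto_nhds_unique (hb _ _)
        (by simpa only [inner_add_left] using (hb x y).add (hb x' y)))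
      (fun c x y => tendsto_nhds_unique (hb _ _)
        (by simpa only [inner_smul_left, smul_eq_mul] using (hb x y).const_mul _))
      (fun x y y' => tendsto_nhds_unique (hb _ _)
        (by simpa only [map_add, inner_add_right] using (hb x y).add (hb x y')))
      (fun c x y => tendsto_nhds_unique (hb _ _)
        (by
          simpa only [map_smul, inner_smul_right, smul_eq_mul, RingHom.id_apply] using
            (hb x y).const_mul c))).mkContinuous₂ M
      hbb
  have hB : ∀ x y, B x y = b x y := fun x y => rfl
  refine ⟨ContinuousLinearMap.adjoint (InnerProductSpace.continuousLinearMapOfBilin B), ?_,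
    fun φ ψ => ?_⟩
  · rw [LinearIsometryEquiv.norm_map]
    refine ContinuousLinearMap.opNorm_le_bound _ hM0 fun v => ?_
    have h1 : ‖InnerProductSpace.continuousLinearMapOfBilin B v‖ = ‖B v‖ :=
      (InnerProductSpace.toDual ℂ (HilbertTensor H K)).symm.norm_map (B v)
    rw [h1]
    exact ContinuousLinearMap.le_of_opNorm_le _ (LinearMap.mkContinuous₂_norm_le _ hM0 _) v
  rw [ContinuousLinearMap.adjoint_inner_right,
    InnerProductSpace.continuousLinearMapOfBilin_apply, hB]
  refine tendsto_nhds_unique (hb _ _) ?_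
  rw [tendsto_iff_norm_sub_tendsto_zero]
  refine squeeze_zero' (g := fun i : Finset K × ℕ => 1 / ((i.2 : ℝ) + 1) * ‖φ‖ ^ 2)
    (Eventually.of_forall fun i => norm_nonneg _) ?_ ?_
  · refine h𝒰le ?_
    filter_upwards [eventually_ge_atTop (({ψ}, 0) : Finset K × ℕ)] with i hi
    exact hT i φ ψ (hi.1 (Finset.mem_singleton_self ψ))
  · have h1 : Tendsto (fun i : Finset K × ℕ => 1 / ((i.2 : ℝ) + 1)) atTop (𝓝 0) :=
      (tendsto_one_div_add_atTop_nhds_zero_nat (𝕜 := ℝ)).comp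
        (by rw [← prod_atTop_atTop_eq]; exact tendsto_snd)
    simpa using (h1.mono_left h𝒰le).mul_const (‖φ‖ ^ 2)

end OperatorIntegral

section Frames

/-- A strongly continuous unitary representation of the topological group `G` on `H`. -/
structure UnitaryRep (G : Type*) [Group G] [TopologicalSpace G] (H : Type*)
    [NormedAddCommGroup H] [InnerProductSpace ℂ H] [CompleteSpace H] where
  /-- The unitary operators. -/
  U : G →* unitary (H →L[ℂ] H)
  continuous_U : ∀ φ : H, Continuous fun g => (U g : H →L[ℂ] H) φ

variable {G : Type*} [Group G] [TopologicalSpace G] {Ω : Type*} [MeasurableSpace Ω]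
  {H K : Type*} [NormedAddCommGroup H] [InnerProductSpace ℂ H] [CompleteSpace H]
  [NormedAddCommGroup K] [InnerProductSpace ℂ K] [CompleteSpace K]

/-- The action `g.A = U(g) A U(g)^*` on bounded operators. -/
def UnitaryRep.conj (V : UnitaryRep G H) (g : G) (A : H →L[ℂ] H) : H →L[ℂ] H :=
  (V.U g : H →L[ℂ] H) * A * star (V.U g : H →L[ℂ] H)

/-- A quantum reference frame: a system of covariance, i.e. a strongly continuous unitary
representation on `H` together with a covariant POVM on a homogeneous `G`-space `Ω`. -/
structure QuantumReferenceFrame (G : Type*) [Group G] [TopologicalSpace G]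
    (Ω : Type*) [TopologicalSpace Ω] [MeasurableSpace Ω] [BorelSpace Ω] [MulAction G Ω]
    [ContinuousSMul G Ω] [MulAction.IsPretransitive G Ω]
    (H : Type*) [NormedAddCommGroup H] [InnerProductSpace ℂ H] [CompleteSpace H] where
  /-- The representation of the group on the Hilbert space of the frame. -/
  rep : UnitaryRep G H
  /-- The frame observable. -/
  povm : POVM Ω H
  covariant : ∀ (g : G) (X : Set Ω), MeasurableSet X →
    povm.effect ((fun x => g • x) '' X) = rep.conj g (povm.effect X)

/-- A frame is localizable if its observable has the norm-1 property. -/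
def QuantumReferenceFrame.IsLocalizable [TopologicalSpace Ω] [BorelSpace Ω] [MulAction G Ω]
    [ContinuousSMul G Ω] [MulAction.IsPretransitive G Ω] (R : QuantumReferenceFrame G Ω H) : Prop :=
  R.povm.IsLocalizable

/-- `Ω` is a principal homogeneous `G`-space (a torsor): each orbit map `g ↦ g • o` identifies
`G` with `Ω`, also topologically. -/
def IsPrincipalHomogeneousSpace (G : Type*) [Group G] [TopologicalSpace G]
    (Ω : Type*) [TopologicalSpace Ω] [MulAction G Ω] : Prop :=
  ∀ o : Ω, IsHomeomorph fun g : G => g • o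

/-- The inverse of the orbit map of the base point `o`: `groupCoord h o x` is the unique `g : G`
with `g • o = x`. -/
def groupCoord [TopologicalSpace Ω] [MulAction G Ω] (hΩ : IsPrincipalHomogeneousSpace G Ω)
    (o : Ω) : Ω ≃ₜ G :=
  ((hΩ o).homeomorph _).symm

theorem groupCoord_smul_base [TopologicalSpace Ω] [MulAction G Ω]
    (hΩ : IsPrincipalHomogeneousSpace G Ω) (o x : Ω) : groupCoord hΩ o x • o = x :=
  ((hΩ o).homeomorph _).apply_symm_apply x

theorem groupCoord_smul [TopologicalSpace Ω] [MulAction G Ω]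
    (hΩ : IsPrincipalHomogeneousSpace G Ω) (o : Ω) (g : G) (x : Ω) :
    groupCoord hΩ o (g • x) = g * groupCoord hΩ o x := by
  apply (hΩ o).bijective.1
  simp only [groupCoord_smul_base, mul_smul]

/-- The space `B(H ⊗ K)^G` of bounded operators on `H ⊗ K` that are invariant under the diagonal
action `g ↦ V(g) ⊗ W(g)`, as a subspace of `B(H ⊗ K)`. -/
def invariantOperators (V : UnitaryRep G H) (W : UnitaryRep G K) :
    Submodule ℂ (HilbertTensor H K →L[ℂ] HilbertTensor H K) where
  carrier := {T | ∀ g : G, prodOp (V.U g : H →L[ℂ] H) (W.U g : K →L[ℂ] K) * T *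
    star (prodOp (V.U g : H →L[ℂ] H) (W.U g : K →L[ℂ] K)) = T}
  zero_mem' := fun g => by simp
  add_mem' := fun {S T} hS hT g => by rw [mul_add, add_mul, hS g, hT g]
  smul_mem' := fun c T hT g => by rw [mul_smul_comm, smul_mul_assoc, hT g]

theorem UnitaryRep.star_U (V : UnitaryRep G H) (g : G) :
    star (V.U g : H →L[ℂ] H) = (V.U g⁻¹ : H →L[ℂ] H) := by
  rw [map_inv]; rfl

theorem UnitaryRep.norm_conj_le (V : UnitaryRep G H) (g : G) (A : H →L[ℂ] H) :
    ‖V.conj g A‖ ≤ ‖A‖ := by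
  rw [UnitaryRep.conj, ← Unitary.coe_star, CStarRing.norm_mul_coe_unitary,
    CStarRing.norm_coe_unitary_mul]

theorem UnitaryRep.inner_conj (V : UnitaryRep G H) (g : G) (A : H →L[ℂ] H) (φ ψ : H) :
    ⟪φ, V.conj g A ψ⟫_ℂ = ⟪(V.U g⁻¹ : H →L[ℂ] H) φ, A ((V.U g⁻¹ : H →L[ℂ] H) ψ)⟫_ℂ := by
  rw [UnitaryRep.conj, V.star_U, mul_apply_eq_comp, mul_apply_eq_comp, ← V.star_U,
    ContinuousLinearMap.star_eq_adjoint, ContinuousLinearMap.adjoint_inner_left]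

theorem UnitaryRep.conj_mul (V : UnitaryRep G H) (g h : G) (A : H →L[ℂ] H) :
    V.conj (g * h) A = V.conj g (V.conj h A) := by
  simp [UnitaryRep.conj, map_mul, mul_assoc]

theorem UnitaryRep.continuous_inner_conj [IsTopologicalGroup G] (V : UnitaryRep G H)
    (A : H →L[ℂ] H) (φ ψ : H) : Continuous fun g => ⟪φ, V.conj g A ψ⟫_ℂ := by
  simp only [V.inner_conj]
  have h : ∀ φ, Continuous fun g : G => (V.U g⁻¹ : H →L[ℂ] H) φ := fun φ =>
    (V.continuous_U φ).comp continuous_inv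
  exact (h φ).inner (A.continuous.comp (h ψ))

variable [IsTopologicalGroup G] [TopologicalSpace Ω] [BorelSpace Ω] [MulAction G Ω]
  [ContinuousSMul G Ω] [MulAction.IsPretransitive G Ω]

/-- The integral defining the relativization of a bounded operator exists. -/
theorem exists_relativization (hΩ : IsPrincipalHomogeneousSpace G Ω) (o : Ω)
    (R : QuantumReferenceFrame G Ω H) (W : UnitaryRep G K) (A : K →L[ℂ] K) :
    ∃ T : HilbertTensor H K →L[ℂ] HilbertTensor H K, ‖T‖ ≤ ‖A‖ ∧
      IsOperatorIntegral R.povm (fun x => W.conj (groupCoord hΩ o x) A) T :=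
  exists_isOperatorIntegral R.povm (norm_nonneg A) (fun _ => W.norm_conj_le _ A) fun ψ =>
    ((W.continuous_inner_conj A ψ ψ).comp (groupCoord hΩ o).continuous).measurable

/-- The bounded operator `∫ dE(g) ⊗ U(g) A U(g)^*`, where `Ω` is identified with `G` through the
base point `o`. -/
def relativizationOp (hΩ : IsPrincipalHomogeneousSpace G Ω) (o : Ω)
    (R : QuantumReferenceFrame G Ω H) (W : UnitaryRep G K) (A : K →L[ℂ] K) :
    HilbertTensor H K →L[ℂ] HilbertTensor H K :=
  (exists_relativization hΩ o R W A).choose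

theorem relativizationOp_spec (hΩ : IsPrincipalHomogeneousSpace G Ω) (o : Ω)
    (R : QuantumReferenceFrame G Ω H) (W : UnitaryRep G K) (A : K →L[ℂ] K) :
    IsOperatorIntegral R.povm (fun x => W.conj (groupCoord hΩ o x) A)
      (relativizationOp hΩ o R W A) :=
  (exists_relativization hΩ o R W A).choose_spec.2

theorem integrable_relativization (hΩ : IsPrincipalHomogeneousSpace G Ω) (o : Ω)
    (R : QuantumReferenceFrame G Ω H) (W : UnitaryRep G K) (A : K →L[ℂ] K) (φ : H) (ψ : K) :
    Integrable (fun x => ⟪ψ, W.conj (groupCoord hΩ o x) A ψ⟫_ℂ) (R.povm.outcomeMeasure φ) :=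
  integrable_inner_apply R.povm (fun _ => W.norm_conj_le _ A) (fun ψ =>
    ((W.continuous_inner_conj A ψ ψ).comp (groupCoord hΩ o).continuous).measurable) φ ψ

theorem outcomeMeasure_rep (R : QuantumReferenceFrame G Ω H) (g : G) (φ : H) :
    R.povm.outcomeMeasure ((R.rep.U g : H →L[ℂ] H) φ) =
      (R.povm.outcomeMeasure φ).map (fun x => g • x) := by
  have hg : Measurable fun x : Ω => g • x := (continuous_const_smul g).measurable
  ext X hX
  rw [Measure.map_apply hg hX, R.povm.outcomeMeasure_apply hX,
    R.povm.outcomeMeasure_apply (hg hX)]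
  have h1 : (fun x : Ω => g • x) ⁻¹' X = (fun x : Ω => g⁻¹ • x) '' X := by
    ext x
    simp only [Set.mem_preimage, Set.mem_image]
    exact ⟨fun h => ⟨g • x, h, by simp⟩, by rintro ⟨y, hy, rfl⟩; simpa using hy⟩
  rw [h1, R.covariant g⁻¹ X hX, R.rep.inner_conj, inv_inv]

theorem relativizationOp_mem (hΩ : IsPrincipalHomogeneousSpace G Ω) (o : Ω)
    (R : QuantumReferenceFrame G Ω H) (W : UnitaryRep G K) (A : K →L[ℂ] K) :
    relativizationOp hΩ o R W A ∈ invariantOperators R.rep W := by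
  intro g
  refine IsOperatorIntegral.unique (fun φ ψ => ?_) (relativizationOp_spec hΩ o R W A)
  have hst : star (prodOp (R.rep.U g : H →L[ℂ] H) (W.U g : K →L[ℂ] K)) =
      prodOp (R.rep.U g⁻¹ : H →L[ℂ] H) (W.U g⁻¹ : K →L[ℂ] K) := by
    rw [ContinuousLinearMap.star_eq_adjoint, prodOp_adjoint, ← ContinuousLinearMap.star_eq_adjoint,
      ← ContinuousLinearMap.star_eq_adjoint, R.rep.star_U, W.star_U]
  rw [mul_apply_eq_comp, mul_apply_eq_comp, ← ContinuousLinearMap.adjoint_inner_left,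
    ← ContinuousLinearMap.star_eq_adjoint, hst, prodOp_prodVec,
    relativizationOp_spec hΩ o R W A, outcomeMeasure_rep, integral_map]
  · refine integral_congr_ae (Eventually.of_forall fun x => ?_)
    simp only [groupCoord_smul, UnitaryRep.conj_mul]
    have hU : (W.U g : K →L[ℂ] K) ((W.U g⁻¹ : K →L[ℂ] K) ψ) = ψ := by
      rw [← mul_apply_eq_comp, ← Submonoid.coe_mul, ← map_mul]
      simp
    rw [W.inner_conj g⁻¹, inv_inv, hU]
  · exact (continuous_const_smul g⁻¹).measurable.aemeasurable
  · exact ((W.continuous_inner_conj A _ _).comp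
      (groupCoord hΩ o).continuous).measurable.aestronglyMeasurable

/-- The relativization map `A ↦ ∫ dE(g) ⊗ U(g) A U(g)^*`, a linear map from `B(K)` to the invariant
operators `B(H ⊗ K)^G`. -/
def relativization (hΩ : IsPrincipalHomogeneousSpace G Ω) (o : Ω)
    (R : QuantumReferenceFrame G Ω H) (W : UnitaryRep G K) :
    (K →L[ℂ] K) →ₗ[ℂ] invariantOperators R.rep W where
  toFun A := ⟨relativizationOp hΩ o R W A, relativizationOp_mem hΩ o R W A⟩
  map_add' A B := Subtype.ext <| (relativizationOp_spec hΩ o R W (A + B)).unique fun φ ψ => by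
    have h := integral_add (integrable_relativization hΩ o R W A φ ψ)
      (integrable_relativization hΩ o R W B φ ψ)
    simp only [Submodule.coe_add, add_apply, inner_add_right,
      relativizationOp_spec hΩ o R W A φ ψ, relativizationOp_spec hΩ o R W B φ ψ, ← h]
    refine integral_congr_ae (Eventually.of_forall fun x => ?_)
    simp [UnitaryRep.conj, mul_add, add_mul]
  map_smul' c A := Subtype.ext <| (relativizationOp_spec hΩ o R W (c • A)).unique fun φ ψ => by
    simp only [Submodule.coe_smul, smul_apply, inner_smul_right, RingHom.id_apply,
      relativizationOp_spec hΩ o R W A φ ψ, ← integral_const_mul]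
    refine integral_congr_ae (Eventually.of_forall fun x => ?_)
    simp [UnitaryRep.conj]

end Frames

end

/-! The estimate `‖yen(A)‖ ≤ ‖A‖` comes with the construction of the integral, so only the lower
bound needs an argument. Localizability says that the frame can be prepared almost sharply near the
base point `o`. There the integrand is almost `A`, since the group coordinate of `o` is the identity
and the representation is strongly continuous. For fixed `ψ`, `ψ'`, a vector `φ` in the unit ball
whose outcome measure is concentrated near `o` thus makes the matrix element of the relativized
operator between `φ ⊗ ψ` and `φ ⊗ ψ'` almost `⟨ψ, A ψ'⟩`, while that element is at most the operator
norm times `‖ψ‖ ‖ψ'‖`.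

Two facts supply `φ`. Every open neighbourhood of `o` has a non-zero effect by covariance
(`QuantumReferenceFrame.effect_ne_zero_of_isOpen`), hence an effect of norm one. A positive operator
nearly attains its norm in its quadratic form (`exists_lt_re_inner_of_isPositive`). The limit is
made quantitative in `norm_mul_le_norm_integral_add`. -/

/-! ### Quadratic forms of positive operators -/

/-- A positive operator of norm one has expectation values arbitrarily close to one in vectors of
the unit ball. -/
theorem exists_lt_re_inner_of_isPositive {H : Type*} [NormedAddCommGroup H] [InnerProductSpace ℂ H]
    [CompleteSpace H] {A : H →L[ℂ] H} (hA : A.IsPositive) {r : ℝ} (hr : r < ‖A‖) :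
    ∃ φ : H, ‖φ‖ ≤ 1 ∧ r < (⟪φ, A φ⟫_ℂ).re := by
  have hSA : CFC.sqrt A * CFC.sqrt A = A :=
    CFC.sqrt_mul_sqrt_self _ ((ContinuousLinearMap.nonneg_iff_isPositive _).2 hA)
  have hSadj : ContinuousLinearMap.adjoint (CFC.sqrt A) = CFC.sqrt A :=
    (IsSelfAdjoint.of_nonneg (CFC.sqrt_nonneg A)).star_eq
  set S : H →L[ℂ] H := CFC.sqrt A with hS
  have hnorm : ‖A‖ = ‖S‖ * ‖S‖ := by
    have h := CStarRing.norm_star_mul_self (x := S)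
    rwa [ContinuousLinearMap.star_eq_adjoint, hSadj, hSA] at h
  -- With the square root, near-maximizing the quadratic form of `A` becomes near-maximizing `‖S
  -- φ‖`, which the definition of the operator norm allows.
  have hinner : ∀ φ, (⟪φ, A φ⟫_ℂ).re = ‖S φ‖ ^ 2 := fun φ => by
    rw [← hSA, mul_apply_eq_comp, ← ContinuousLinearMap.adjoint_inner_left, hSadj,
      inner_self_eq_norm_sq_to_K]
    simp [← Complex.ofReal_pow]
  -- Negative `r` is split off because `A` may vanish: then `√r = 0 = ‖S‖` and the strict inequality
  -- fails, but `φ = 0` serves as witness.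
  have hlt : Real.sqrt r < ‖S‖ ∨ r < 0 := by
    by_cases h0 : r < 0
    · exact Or.inr h0
    · left
      rw [Real.sqrt_lt' (by
        rcases (norm_nonneg S).eq_or_lt with h | h
        · rw [hnorm, ← h] at hr; simp at hr; exact absurd hr h0
        · exact h), sq, ← hnorm]
      exact hr
  rcases hlt with hlt | h0
  · obtain ⟨φ, hφ, hφr⟩ := S.exists_lt_apply_of_lt_opNorm hlt
    exact ⟨φ, hφ.le, by
      rw [hinner]
      exact (Real.sqrt_lt' ((Real.sqrt_nonneg r).trans_lt hφr)).1 hφr⟩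
  · exact ⟨0, by simp, by simpa using h0⟩

/-! ### Off-diagonal matrix elements and concentrated measures -/

section OperatorIntegral

variable {Ω : Type*} [MeasurableSpace Ω] {H K : Type*} [NormedAddCommGroup H]
  [InnerProductSpace ℂ H] [NormedAddCommGroup K] [InnerProductSpace ℂ K]

/-- Matrix elements of an operator integral, off-diagonal in the second factor. -/
theorem IsOperatorIntegral.inner_eq_integral {E : POVM Ω H} {f : Ω → (K →L[ℂ] K)}
    {T : HilbertTensor H K →L[ℂ] HilbertTensor H K} (hT : IsOperatorIntegral E f T) (φ : H)
    (hf : ∀ ψ ψ', Integrable (fun x => ⟪ψ, f x ψ'⟫_ℂ) (E.outcomeMeasure φ)) (ψ ψ' : K) :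
    ⟪prodVec φ ψ, T (prodVec φ ψ')⟫_ℂ = ∫ x, ⟪ψ, f x ψ'⟫_ℂ ∂(E.outcomeMeasure φ) := by
  -- Complex polarization in the second factor only: the difference of the two sides is sesquilinear
  -- in `ψ`, `ψ'` and vanishes on the diagonal. Keeping `φ` the same on both sides keeps the
  -- integrating measure positive. Additivity of the integral is where off-diagonal integrability
  -- enters.
  refine sub_eq_zero.1 <| sesq_eq_zero
    (fun ψ ψ' => ⟪prodVec φ ψ, T (prodVec φ ψ')⟫_ℂ - ∫ x, ⟪ψ, f x ψ'⟫_ℂ ∂(E.outcomeMeasure φ))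
    (fun x y z => ?_) (fun x y z => ?_) (fun c x y => ?_) (fun c x y => ?_) (fun x => ?_) ψ ψ'
  · simp only [prodVec_add_right, inner_add_left, integral_add (hf _ _) (hf _ _)]
    ring
  · simp only [prodVec_add_right, map_add, inner_add_right, integral_add (hf _ _) (hf _ _)]
    ring
  · simp only [prodVec_smul_right, inner_smul_left, integral_const_mul]
    ring
  · simp only [prodVec_smul_right, map_smul, inner_smul_right, integral_const_mul]
    ring
  · exact sub_eq_zero.2 (hT φ x)

theorem norm_prodVec (φ : H) (ψ : K) : ‖prodVec φ ψ‖ = ‖φ‖ * ‖ψ‖ := by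
  simp [prodVec, TensorProduct.norm_tmul]

end OperatorIntegral

/-- If a bounded function is `ε`-close to `a` on a set of measure at least `r`, and the total mass
is at most one, then its integral controls `a`. -/
theorem norm_mul_le_norm_integral_add {Ω : Type*} [MeasurableSpace Ω] {μ : Measure Ω}
    [IsFiniteMeasure μ] {h : Ω → ℂ} (hh : Integrable h μ) {a : ℂ} {C ε r : ℝ} (hε : 0 ≤ ε)
    (hC : ∀ x, ‖h x‖ ≤ C) (ha : ‖a‖ ≤ C) {U : Set Ω} (hU : MeasurableSet U)
    (hUε : ∀ x ∈ U, ‖h x - a‖ ≤ ε) (hμ : μ.real Set.univ ≤ 1) (hr : r ≤ μ.real U) :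
    ‖a‖ * r ≤ ‖∫ x, h x ∂μ‖ + ε + 2 * C * (1 - r) := by
  have hC0 : 0 ≤ C := (norm_nonneg a).trans ha
  -- The deviation from `a` is at most `ε` on `U` and at most `2 * C` elsewhere.
  have h1 : ‖∫ x, (h x - a) ∂μ‖ ≤ ∫ x, (ε + Uᶜ.indicator (fun _ => 2 * C) x) ∂μ := by
    refine norm_integral_le_of_norm_le ((integrable_const _).add
      ((integrable_const _).indicator hU.compl)) (Eventually.of_forall fun x => ?_)
    by_cases hx : x ∈ U
    · simpa [hx] using hUε x hx
    · have := norm_sub_le (h x) a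
      have := hC x
      simp only [Set.mem_compl_iff, hx, not_false_eq_true, Set.indicator_of_mem]
      linarith
  rw [integral_add (integrable_const _) ((integrable_const _).indicator hU.compl),
    integral_indicator_const _ hU.compl, integral_const, integral_sub hh (integrable_const _),
    integral_const, measureReal_compl hU] at h1
  simp only [smul_eq_mul, Complex.real_smul] at h1
  -- The measure need not be normalized, so the integral is compared with total mass times `a`; the
  -- mass lies between `r` and `1`, and each bound is used once below.
  have h2 : ‖(μ.real Set.univ : ℂ) * a‖ = μ.real Set.univ * ‖a‖ := by
    rw [norm_mul, Complex.norm_real, Real.norm_of_nonneg measureReal_nonneg]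
  have h3 := norm_sub_norm_le ((μ.real Set.univ : ℂ) * a) (∫ x, h x ∂μ)
  rw [norm_sub_rev] at h3
  have h4 : μ.real U ≤ μ.real Set.univ := measureReal_mono (Set.subset_univ U)
  have h5 : ‖a‖ * r ≤ μ.real Set.univ * ‖a‖ := by
    rw [mul_comm]; gcongr; exact hr.trans h4
  have h6 : μ.real Set.univ * ε ≤ ε := mul_le_of_le_one_left hε hμ
  have h7 : (μ.real Set.univ - μ.real U) * (2 * C) ≤ 2 * C * (1 - r) := by
    rw [mul_comm]; gcongr
  linarith

/-! ### Covariance, localization and the isometry -/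

section Frames

variable {G : Type*} [Group G] [TopologicalSpace G]
  {Ω : Type*} [TopologicalSpace Ω] [MeasurableSpace Ω] [BorelSpace Ω] [MulAction G Ω]
  [ContinuousSMul G Ω] [MulAction.IsPretransitive G Ω]
  {H K : Type*} [NormedAddCommGroup H] [InnerProductSpace ℂ H] [CompleteSpace H]
  [NormedAddCommGroup K] [InnerProductSpace ℂ K] [CompleteSpace K]

/-- By covariance, the observable of a frame charges every nonempty open set. -/
theorem QuantumReferenceFrame.effect_ne_zero_of_isOpen [SecondCountableTopology Ω] [Nontrivial H]
    (R : QuantumReferenceFrame G Ω H) {U : Set Ω} (hU : IsOpen U) (hne : U.Nonempty) :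
    R.povm.effect U ≠ 0 := by
  intro h0
  obtain ⟨x₀, hx₀⟩ := hne
  -- By transitivity the translates of `U` cover the space, and by covariance their effects are
  -- unitarily conjugate to that of `U`, hence zero too.
  choose g hg using fun x : Ω => MulAction.exists_smul_eq G x₀ x
  have hopen : ∀ x, IsOpen ((fun y => g x • y) '' U) := fun x => isOpenMap_smul (g x) U hU
  -- Second countability cuts the cover down to countably many null sets, so the outcome measure of
  -- `φ` would vanish, although its total mass is `‖φ‖ ^ 2 > 0`.
  obtain ⟨s, hs, hcover⟩ := TopologicalSpace.countable_cover_nhds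
    (f := fun x => (fun y => g x • y) '' U)
    fun x => (hopen x).mem_nhds ⟨x₀, hx₀, hg x⟩
  obtain ⟨φ, hφ⟩ := exists_ne (0 : H)
  have hzero : R.povm.outcomeMeasure φ Set.univ = 0 := by
    rw [← hcover]
    refine (measure_biUnion_null_iff hs).2 fun x _ => ?_
    rw [R.povm.outcomeMeasure_apply (hopen x).measurableSet,
      R.covariant _ _ hU.measurableSet, h0]
    simp [UnitaryRep.conj]
  rw [R.povm.outcomeMeasure_univ, ENNReal.ofReal_eq_zero] at hzero
  exact absurd hzero (not_le.2 (by positivity))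

variable [IsTopologicalGroup G]

theorem norm_relativizationOp_le (hΩ : IsPrincipalHomogeneousSpace G Ω) (o : Ω)
    (R : QuantumReferenceFrame G Ω H) (W : UnitaryRep G K) (A : K →L[ℂ] K) :
    ‖relativizationOp hΩ o R W A‖ ≤ ‖A‖ :=
  (exists_relativization hΩ o R W A).choose_spec.1

/-- Frame vectors localized ever more sharply near `o` recover the matrix elements of `A`. Two
independent vectors `ψ`, `ψ'` are needed: the diagonal case would only control the numerical radius
of `A`, which can be smaller than its norm. -/
theorem norm_inner_le_norm_relativizationOp [SecondCountableTopology Ω] [Nontrivial H]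
    (hΩ : IsPrincipalHomogeneousSpace G Ω) (o : Ω) (R : QuantumReferenceFrame G Ω H)
    (hR : R.IsLocalizable) (W : UnitaryRep G K) (A : K →L[ℂ] K) (ψ ψ' : K) :
    ‖⟪ψ, A ψ'⟫_ℂ‖ ≤ ‖relativizationOp hΩ o R W A‖ * (‖ψ‖ * ‖ψ'‖) := by
  set T := relativizationOp hΩ o R W A with hT
  set f : Ω → (K →L[ℂ] K) := fun x => W.conj (groupCoord hΩ o x) A with hf
  set C : ℝ := ‖ψ‖ * (‖A‖ * ‖ψ'‖) with hC
  have hcont : ∀ ψ ψ', Continuous fun x => ⟪ψ, f x ψ'⟫_ℂ := fun ψ ψ' =>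
    (W.continuous_inner_conj A ψ ψ').comp (groupCoord hΩ o).continuous
  have hbound : ∀ ψ ψ' x, ‖⟪ψ, f x ψ'⟫_ℂ‖ ≤ ‖ψ‖ * (‖A‖ * ‖ψ'‖) := fun ψ ψ' x =>
    (norm_inner_le_norm _ _).trans <| by
      gcongr
      exact (f x).le_of_opNorm_le (W.norm_conj_le _ A) ψ'
  have hint : ∀ φ ψ ψ', Integrable (fun x => ⟪ψ, f x ψ'⟫_ℂ) (R.povm.outcomeMeasure φ) :=
    fun φ ψ ψ' => Integrable.of_bound (hcont ψ ψ').measurable.aestronglyMeasurable _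
      (Eventually.of_forall (hbound ψ ψ'))
  have hfo : f o = A := by
    have h1 : groupCoord hΩ o o = 1 := (hΩ o).bijective.1 <| by
      simp only [groupCoord_smul_base, one_smul]
    simp [hf, h1, UnitaryRep.conj]
  set a := ⟪ψ, A ψ'⟫_ℂ with ha
  have key : ∀ ε : ℝ, 0 < ε → ‖a‖ * (1 - ε) ≤ ‖T‖ * (‖ψ‖ * ‖ψ'‖) + ε + 2 * C * ε := by
    intro ε hε
    -- The neighbourhood depends on `ψ` and `ψ'`: only weak continuity of the conjugated operator is
    -- available, which is enough for one matrix element.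
    set U : Set Ω := {x | ‖⟪ψ, f x ψ'⟫_ℂ - a‖ < ε} with hUdef
    have hU : IsOpen U :=
      isOpen_lt ((hcont ψ ψ').sub continuous_const).norm continuous_const
    have hoU : o ∈ U := by simp [hUdef, hfo, ha, hε]
    have hnorm := hR U hU.measurableSet (R.effect_ne_zero_of_isOpen hU ⟨o, hoU⟩)
    -- The same `ε` serves as oscillation on `U` and as mass deficit off `U`. It need not be small,
    -- as `1 - ε` is allowed to be negative.
    obtain ⟨φ, hφ, hφr⟩ := exists_lt_re_inner_of_isPositive
      (R.povm.effect_isPositive U hU.measurableSet) (r := 1 - ε) (by rw [hnorm]; linarith)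
    have hmass : (R.povm.outcomeMeasure φ).real Set.univ ≤ 1 := by
      rw [Measure.real, R.povm.outcomeMeasure_univ, ENNReal.toReal_ofReal (by positivity)]
      exact pow_le_one₀ (norm_nonneg φ) hφ
    have hmassU : 1 - ε ≤ (R.povm.outcomeMeasure φ).real U := by
      rw [Measure.real, R.povm.outcomeMeasure_apply hU.measurableSet,
        ENNReal.toReal_ofReal (R.povm.re_inner_effect_nonneg hU.measurableSet φ)]
      exact hφr.le
    have h1 := norm_mul_le_norm_integral_add (hint φ ψ ψ') hε.le (hbound ψ ψ')
      (by simpa only [hfo] using hbound ψ ψ' o) hU.measurableSet (fun x hx => le_of_lt hx)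
      hmass hmassU
    rw [← (relativizationOp_spec hΩ o R W A).inner_eq_integral φ (hint φ)] at h1
    have h2 : ‖⟪prodVec φ ψ, T (prodVec φ ψ')⟫_ℂ‖ ≤ ‖T‖ * (‖ψ‖ * ‖ψ'‖) :=
      calc _ ≤ ‖prodVec φ ψ‖ * (‖T‖ * ‖prodVec φ ψ'‖) :=
            (norm_inner_le_norm _ _).trans (by gcongr; exact T.le_opNorm _)
        _ ≤ (1 * ‖ψ‖) * (‖T‖ * (1 * ‖ψ'‖)) := by
            rw [norm_prodVec, norm_prodVec]; gcongr
        _ = _ := by ring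
    have h3 : (1 : ℝ) - (1 - ε) = ε := by ring
    rw [h3] at h1
    linarith
  -- Let `ε` tend to zero from the right; `C` does not depend on `ε` or `φ`.
  have hlim : Tendsto (fun ε : ℝ => ‖a‖ * (1 - ε)) (𝓝[>] 0) (𝓝 (‖a‖ * (1 - 0))) :=
    (Continuous.tendsto (by fun_prop) 0).mono_left nhdsWithin_le_nhds
  have hlim' : Tendsto (fun ε : ℝ => ‖T‖ * (‖ψ‖ * ‖ψ'‖) + ε + 2 * C * ε) (𝓝[>] 0)
      (𝓝 (‖T‖ * (‖ψ‖ * ‖ψ'‖) + 0 + 2 * C * 0)) :=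
    (Continuous.tendsto (by fun_prop) 0).mono_left nhdsWithin_le_nhds
  simpa using le_of_tendsto_of_tendsto hlim hlim' (eventually_mem_nhdsWithin.mono key)

theorem norm_relativizationOp [SecondCountableTopology Ω] [Nontrivial H]
    (hΩ : IsPrincipalHomogeneousSpace G Ω) (o : Ω) (R : QuantumReferenceFrame G Ω H)
    (hR : R.IsLocalizable) (W : UnitaryRep G K) (A : K →L[ℂ] K) :
    ‖relativizationOp hΩ o R W A‖ = ‖A‖ := by
  refine (norm_relativizationOp_le hΩ o R W A).antisymm <|
    A.opNorm_le_bound (by positivity) fun ψ => ?_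
  -- Testing against `A ψ` itself gives `‖A ψ‖ ^ 2` on the left; one factor is then cancelled when
  -- it is non-zero.
  have h := norm_inner_le_norm_relativizationOp hΩ o R hR W A (A ψ) ψ
  rw [inner_self_eq_norm_sq_to_K] at h
  rcases (norm_nonneg (A ψ)).eq_or_lt with h0 | h0
  · rw [← h0]; positivity
  · refine le_of_mul_le_mul_left ?_ h0
    calc ‖A ψ‖ * ‖A ψ‖ = ‖((‖A ψ‖ : ℂ)) ^ 2‖ := by simp [sq]
      _ ≤ _ := h
      _ = _ := by ring

end Frames

/-- The relativization map of a localizable principal frame is isometric, hence injective. -/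
theorem mainTheorem4
    {G : Type*} [Group G] [TopologicalSpace G] [IsTopologicalGroup G] [T2Space G]
    [LocallyCompactSpace G] [SecondCountableTopology G]
    {Ω : Type*} [TopologicalSpace Ω] [MeasurableSpace Ω] [BorelSpace Ω] [MulAction G Ω]
    [ContinuousSMul G Ω] [MulAction.IsPretransitive G Ω]
    {HR : Type*} [NormedAddCommGroup HR] [InnerProductSpace ℂ HR] [CompleteSpace HR] [Nontrivial HR]
    {HS : Type*} [NormedAddCommGroup HS] [InnerProductSpace ℂ HS] [CompleteSpace HS]
    (hΩ : IsPrincipalHomogeneousSpace G Ω) (o : Ω)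
    (R : QuantumReferenceFrame G Ω HR) (hR : R.IsLocalizable)
    (US : UnitaryRep G HS) :
    Isometry (relativization hΩ o R US) ∧ Function.Injective (relativization hΩ o R US) := by
  have : SecondCountableTopology Ω := (groupCoord hΩ o).secondCountableTopology
  have h : Isometry (relativization hΩ o R US) :=
    fun A B => by
      -- Distances among invariant operators are those of the ambient operator space, so linearity
      -- reduces the claim to norm preservation at `A - B`.
      change edist (relativization hΩ o R US A).1 (relativization hΩ o R US B).1 = edist A B
      rw [edist_dist, edist_dist, dist_eq_norm, dist_eq_norm, ← Submodule.coe_sub, ← map_sub]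
      exact congrArg ENNReal.ofReal (norm_relativizationOp hΩ o R hR US (A - B))
  exact ⟨h, h.injective⟩
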